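/- Let $\lambda$-terms be the usual finite terms (possibly with free variables, up to $\alpha$-equivalence), let $M \twoheadrightarrow_\beta P$ mean that $P$ is obtained from $M$ by zero or more $\beta$-steps ($P$ is a reduct of $M$), and let $=_\beta$ be the equivalence relation generated by $\beta$-steps. The $\lambda\tau$-terms are the finite and infinite terms built from variables, abstraction, application and a unary symbol $\tau$. For a set of rules, applied at arbitrary positions with one-step relation $\to$, infinitary (strongly convergent) rewriting $\twoheadrightarrow^\infty$ is the greatest relation such that $s \twoheadrightarrow^\infty t$ implies that $s$ rewrites in finitely many steps $\to$ to a term that has the same root symbol as $t$ and whose arguments are related by $\twoheadrightarrow^\infty$ to the corresponding arguments of $t$. The clocked $\lambda$-calculus is the rewrite system on $\lambda\tau$-terms with the rules $$(\lambda x.s)\,t \to \tau(s[x:=t]), \qquad \tau(s)\,t \to \tau(s\,t).$$ The clocked Lévy tree $\mathrm{LT}_\tau(s)$ of a term $s$ is the unique normal form $t$ of the clocked $\lambda$-calculus with $s \twoheadrightarrow^\infty t$ in that calculus. A term $s$ is globally improved by a term $u$ if $\mathrm{LT}_\tau(s) \twoheadrightarrow^\infty_\tau \mathrm{LT}_\tau(u)$,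 where $\twoheadrightarrow^\infty_\tau$ is infinitary rewriting with the single rule $\tau(t) \to t$. Theorem. Let $M$ and $N$ be $\lambda$-terms. If there is no $\lambda$-term $P$ with $M \twoheadrightarrow_\beta P$ such that $N$ is globally improved by $P$, then $M \neq_\beta N$. -/

import Mathlib

namespace ClockedLambda

/-! ### Finite λ-terms (de Bruijn), β-reduction and β-conversion -/

/-- Finite λ-terms up to α-equivalence, with de Bruijn indices; free variables are allowed. -/
inductive Term : Type
  | var (n : ℕ) : Term
  | lam (M : Term) : Term
  | app (M N : Term) : Term

/-- Extension of a renaming under a binder. -/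
def upRen (ρ : ℕ → ℕ) : ℕ → ℕ
  | 0 => 0
  | n + 1 => ρ n + 1

namespace Term

/-- Renaming of free variables. -/
def rename (ρ : ℕ → ℕ) : Term → Term
  | var n => var (ρ n)
  | lam M => lam (rename (upRen ρ) M)
  | app M N => app (rename ρ M) (rename ρ N)

/-- Extension of a substitution under a binder. -/
def up (σ : ℕ → Term) : ℕ → Term
  | 0 => var 0
  | n + 1 => rename Nat.succ (σ n)

/-- Simultaneous capture-avoiding substitution. -/
def subst (σ : ℕ → Term) : Term → Term
  | var n => σ n
  | lam M => lam (subst (up σ) M)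
  | app M N => app (subst σ M) (subst σ N)

/-- The substitution that replaces index `0` by `N` and lowers all other indices. -/
def single (N : Term) : ℕ → Term
  | 0 => N
  | n + 1 => var n

/-- One β-step: the closure of `(λx.M) N → M[x := N]` under contexts. -/
inductive Beta : Term → Term → Prop
  | beta (M N : Term) : Beta (app (lam M) N) (subst (single N) M)
  | lam {M M' : Term} : Beta M M' → Beta (lam M) (lam M')
  | appL {M M' : Term} (N : Term) : Beta M M' → Beta (app M N) (app M' N)
  | appR (M : Term) {N N' : Term} : Beta N N' → Beta (app M N) (app M N')

/-- `M.Reduces P`: `P` is a β-reduct of `M` (zero or more β-steps). -/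
def Reduces : Term → Term → Prop := Relation.ReflTransGen Beta

/-- β-convertibility: the equivalence relation generated by β-steps. -/
def Conv : Term → Term → Prop := Relation.EqvGen Beta

end Term

/-! ### Finite and infinite λτ-terms -/

/-- The symbols of λτ-terms: variables (de Bruijn), abstraction, application and `τ`. -/
inductive Sym : Type
  | var (n : ℕ) : Sym
  | lam : Sym
  | app : Sym
  | tau : Sym

/-- The number of arguments of a symbol. -/
def Sym.arity : Sym → ℕ
  | .var _ => 0
  | .lam => 1
  | .app => 2
  | .tau => 1

/-- The signature of λτ-terms as a polynomial functor. -/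
def sig : PFunctor.{0, 0} := ⟨Sym, fun a => Fin a.arity⟩

/-- The finite and infinite λτ-terms: the final coalgebra of the signature. -/
abbrev ITerm : Type := sig.M

namespace ITerm

def var (n : ℕ) : ITerm := PFunctor.M.mk ⟨Sym.var n, (Fin.elim0 : Fin 0 → ITerm)⟩

def lam (t : ITerm) : ITerm := PFunctor.M.mk ⟨Sym.lam, (fun _ => t : Fin 1 → ITerm)⟩

def app (s t : ITerm) : ITerm := PFunctor.M.mk ⟨Sym.app, (![s, t] : Fin 2 → ITerm)⟩

def tau (t : ITerm) : ITerm := PFunctor.M.mk ⟨Sym.tau, (fun _ => t : Fin 1 → ITerm)⟩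

/-- One layer of the renaming of an infinite term. -/
def renameLayer (ρ : ℕ → ℕ) : sig ITerm → sig (ITerm × (ℕ → ℕ))
  | ⟨Sym.var n, _⟩ => ⟨Sym.var (ρ n), fun i => Fin.elim0 i⟩
  | ⟨Sym.lam, c⟩ => ⟨Sym.lam, fun i => (c i, upRen ρ)⟩
  | ⟨Sym.app, c⟩ => ⟨Sym.app, fun i => (c i, ρ)⟩
  | ⟨Sym.tau, c⟩ => ⟨Sym.tau, fun i => (c i, ρ)⟩

/-- Renaming of free variables, by corecursion. -/
def rename (ρ : ℕ → ℕ) (t : ITerm) : ITerm :=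
  PFunctor.M.corec (fun p : ITerm × (ℕ → ℕ) => renameLayer p.2 (PFunctor.M.dest p.1)) (t, ρ)

/-- Extension of a substitution under a binder. -/
def up (σ : ℕ → ITerm) : ℕ → ITerm
  | 0 => var 0
  | n + 1 => rename Nat.succ (σ n)

/-- One layer of a substitution. A state `inl (t, σ)` stands for the term `t` with `σ` still to be
applied, a state `inr t` for the term `t` itself. -/
def substLayer (σ : ℕ → ITerm) : sig ITerm → sig ((ITerm × (ℕ → ITerm)) ⊕ ITerm)
  | ⟨Sym.var n, _⟩ => sig.map Sum.inr (PFunctor.M.dest (σ n))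
  | ⟨Sym.lam, c⟩ => ⟨Sym.lam, fun i => Sum.inl (c i, up σ)⟩
  | ⟨Sym.app, c⟩ => ⟨Sym.app, fun i => Sum.inl (c i, σ)⟩
  | ⟨Sym.tau, c⟩ => ⟨Sym.tau, fun i => Sum.inl (c i, σ)⟩

/-- The coalgebra that generates substituted terms. -/
def substStep : (ITerm × (ℕ → ITerm)) ⊕ ITerm → sig ((ITerm × (ℕ → ITerm)) ⊕ ITerm)
  | Sum.inl p => substLayer p.2 (PFunctor.M.dest p.1)
  | Sum.inr t => sig.map Sum.inr (PFunctor.M.dest t)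

/-- Simultaneous capture-avoiding substitution in infinite terms, by corecursion. -/
def subst (σ : ℕ → ITerm) (t : ITerm) : ITerm := PFunctor.M.corec substStep (Sum.inl (t, σ))

/-- The substitution that replaces index `0` by `t` and lowers all other indices. -/
def single (t : ITerm) : ℕ → ITerm
  | 0 => t
  | n + 1 => var n

/-! The computation rules of renaming and substitution. -/

theorem corec_inr (t : ITerm) : PFunctor.M.corec substStep (Sum.inr t) = t := by
  refine PFunctor.M.bisim (fun a b => a = PFunctor.M.corec substStep (Sum.inr b)) ?_ _ _ rfl
  rintro a b rfl
  refine ⟨(PFunctor.M.dest b).1, _, (PFunctor.M.dest b).2, ?_, rfl, fun i => rfl⟩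
  rw [PFunctor.M.dest_corec]
  rfl

theorem mk_congr {a : Sym} {f g : Fin a.arity → ITerm} (h : ∀ i, f i = g i) :
    (PFunctor.M.mk ⟨a, f⟩ : ITerm) = PFunctor.M.mk ⟨a, g⟩ :=
  congrArg (fun c : Fin a.arity → ITerm => (PFunctor.M.mk ⟨a, c⟩ : ITerm)) (funext h)

theorem rename_mk (ρ : ℕ → ℕ) (x : sig ITerm) : rename ρ (PFunctor.M.mk x) =
    PFunctor.M.mk (sig.map (fun p : ITerm × (ℕ → ℕ) => rename p.2 p.1) (renameLayer ρ x)) :=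
  (PFunctor.M.corec_def _ _).trans (congrArg
    (fun y => PFunctor.M.mk (sig.map (fun p : ITerm × (ℕ → ℕ) => rename p.2 p.1) (renameLayer ρ y)))
    (PFunctor.M.dest_mk x))

theorem rename_var (ρ : ℕ → ℕ) (n : ℕ) : rename ρ (var n) = var (ρ n) :=
  (rename_mk ρ _).trans (mk_congr (a := Sym.var (ρ n)) fun i => Fin.elim0 i)

theorem rename_lam (ρ : ℕ → ℕ) (t : ITerm) : rename ρ (lam t) = lam (rename (upRen ρ) t) :=
  rename_mk ρ _

theorem rename_app (ρ : ℕ → ℕ) (s t : ITerm) :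
    rename ρ (app s t) = app (rename ρ s) (rename ρ t) :=
  (rename_mk ρ _).trans (mk_congr (a := Sym.app) (Fin.forall_fin_two.2 ⟨rfl, rfl⟩))

theorem rename_tau (ρ : ℕ → ℕ) (t : ITerm) : rename ρ (tau t) = tau (rename ρ t) :=
  rename_mk ρ _

theorem subst_mk (σ : ℕ → ITerm) (x : sig ITerm) : subst σ (PFunctor.M.mk x) =
    PFunctor.M.mk (sig.map (PFunctor.M.corec substStep) (substLayer σ x)) :=
  (PFunctor.M.corec_def _ _).trans (congrArg
    (fun y => PFunctor.M.mk (sig.map (PFunctor.M.corec substStep) (substLayer σ y)))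
    (PFunctor.M.dest_mk x))

theorem subst_var (σ : ℕ → ITerm) (n : ℕ) : subst σ (var n) = σ n :=
  (subst_mk σ _).trans ((PFunctor.M.corec_def substStep (Sum.inr (σ n))).symm.trans
    (corec_inr (σ n)))

theorem subst_lam (σ : ℕ → ITerm) (t : ITerm) : subst σ (lam t) = lam (subst (up σ) t) :=
  subst_mk σ _

theorem subst_app (σ : ℕ → ITerm) (s t : ITerm) :
    subst σ (app s t) = app (subst σ s) (subst σ t) :=
  (subst_mk σ _).trans (mk_congr (a := Sym.app) (Fin.forall_fin_two.2 ⟨rfl, rfl⟩))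

theorem subst_tau (σ : ℕ → ITerm) (t : ITerm) : subst σ (tau t) = tau (subst σ t) :=
  subst_mk σ _

end ITerm

/-- A λ-term, read as a λτ-term (without occurrences of `τ`). -/
def Term.toITerm : Term → ITerm
  | .var n => ITerm.var n
  | .lam M => ITerm.lam M.toITerm
  | .app M N => ITerm.app M.toITerm N.toITerm

/-! ### Rewriting of infinite terms -/

/-- One rewrite step at an arbitrary position: the closure of the relation `R` of root steps
under contexts. -/
inductive Step (R : ITerm → ITerm → Prop) : ITerm → ITerm → Prop
  | root {s t : ITerm} : R s t → Step R s t
  | lam {s s' : ITerm} : Step R s s' → Step R (ITerm.lam s) (ITerm.lam s')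
  | appL {s s' : ITerm} (t : ITerm) : Step R s s' → Step R (ITerm.app s t) (ITerm.app s' t)
  | appR (s : ITerm) {t t' : ITerm} : Step R t t' → Step R (ITerm.app s t) (ITerm.app s t')
  | tau {s s' : ITerm} : Step R s s' → Step R (ITerm.tau s) (ITerm.tau s')

/-- `Below S s t`: the terms `s` and `t` have the same root symbol, and their arguments are pairwise
related by `S`. -/
inductive Below (S : ITerm → ITerm → Prop) : ITerm → ITerm → Prop
  | var (n : ℕ) : Below S (ITerm.var n) (ITerm.var n)
  | lam {s t : ITerm} : S s t → Below S (ITerm.lam s) (ITerm.lam t)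
  | app {s s' t t' : ITerm} : S s t → S s' t' → Below S (ITerm.app s s') (ITerm.app t t')
  | tau {s t : ITerm} : S s t → Below S (ITerm.tau s) (ITerm.tau t)

/-- Infinitary (strongly convergent) rewriting with root steps `R`, defined coinductively: it is the
greatest relation `S` such that `S s t` implies that finitely many steps lead from `s` to a term
with the root symbol of `t`, whose arguments are related by `S` to those of `t`. -/
def InfRed (R : ITerm → ITerm → Prop) (s t : ITerm) : Prop :=
  ∃ S : ITerm → ITerm → Prop, S s t ∧
    ∀ a b, S a b → ∃ c, Relation.ReflTransGen (Step R) a c ∧ Below S c b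

/-- Normal forms: terms that admit no step. -/
def NormalForm (R : ITerm → ITerm → Prop) (t : ITerm) : Prop := ∀ u, ¬ Step R t u

/-- The two rules of the clocked λ-calculus: `(λx.s) t → τ(s[x := t])` and `τ(s) t → τ(s t)`. -/
inductive ClockedRule : ITerm → ITerm → Prop
  | beta (s t : ITerm) :
      ClockedRule (ITerm.app (ITerm.lam s) t) (ITerm.tau (ITerm.subst (ITerm.single t) s))
  | lift (s t : ITerm) :
      ClockedRule (ITerm.app (ITerm.tau s) t) (ITerm.tau (ITerm.app s t))

/-- The rule `τ(s) → s`. -/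
inductive TauRule : ITerm → ITerm → Prop
  | del (s : ITerm) : TauRule (ITerm.tau s) s

/-- `t` is an infinitary normal form of `s` in the clocked λ-calculus. -/
def IsInfNormalFormOf (s t : ITerm) : Prop := InfRed ClockedRule s t ∧ NormalForm ClockedRule t

/-- `t` is the clocked Lévy tree of `s`: the unique infinitary normal form of `s` in the clocked
λ-calculus. -/
def IsClockedLevyTree (s t : ITerm) : Prop :=
  IsInfNormalFormOf s t ∧ ∀ t', IsInfNormalFormOf s t' → t' = t

/-- `GloballyImprovedBy s u`: the clocked Lévy tree of `s` reduces, by infinitary rewriting with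
the rule `τ(t) → t`, to that of `u`. -/
def GloballyImprovedBy (s u : ITerm) : Prop :=
  ∃ t v, IsClockedLevyTree s t ∧ IsClockedLevyTree u v ∧ InfRed TauRule t v

end ClockedLambda

namespace ClockedLambda

/-! The contrapositive is proved. If `M` and `N` are β-convertible, Church–Rosser gives a common
reduct `P`, so it suffices that every β-reduct of a term globally improves it (`infRed_tau_tree`).

In the clocked calculus each contraction of a head redex leaves a `τ` at the root, and a `τ` in
function position moves outward. Clocked head reduction therefore reaches a stable root by
structural recursion (`head`), and iterating it corecursively gives a total function `tree`. This is
the clocked Lévy tree: a redex in it would contradict the stability of head forms, and any other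
infinitary normal form is bisimilar to it (`eq_tree`).

For a β-reduct, the head form can only lose leading `τ`s: each `τ` records a head redex, and a redex
already contracted on the right is missing there. `Par.peelBelow` makes this precise for one
parallel step: after removal of finitely many `τ`s the roots agree, and the arguments are again
related by a parallel step. Read coinductively, this is infinitary rewriting with `τ(t) → t`. -/

/-- Finite λτ-terms. -/
inductive FTerm : Type
  | var (n : ℕ) : FTerm
  | lam (s : FTerm) : FTerm
  | app (s t : FTerm) : FTerm
  | tau (s : FTerm) : FTerm

namespace FTerm

/-! ### Renaming and substitution in finite λτ-terms -/

def rename (ρ : ℕ → ℕ) : FTerm → FTerm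
  | var n => var (ρ n)
  | lam s => lam (rename (upRen ρ) s)
  | app s t => app (rename ρ s) (rename ρ t)
  | tau s => tau (rename ρ s)

def up (σ : ℕ → FTerm) : ℕ → FTerm
  | 0 => var 0
  | n + 1 => rename Nat.succ (σ n)

def subst (σ : ℕ → FTerm) : FTerm → FTerm
  | var n => σ n
  | lam s => lam (subst (up σ) s)
  | app s t => app (subst σ s) (subst σ t)
  | tau s => tau (subst σ s)

def single (t : FTerm) : ℕ → FTerm
  | 0 => t
  | n + 1 => var n

theorem rename_eq_subst (ρ : ℕ → ℕ) (s : FTerm) : rename ρ s = subst (fun n => var (ρ n)) s := by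
  induction s generalizing ρ with
  | var n => rfl
  | lam s ih =>
    have : up (fun n => var (ρ n)) = fun n => var (upRen ρ n) := by
      funext n; cases n <;> rfl
    simp [rename, subst, ih, this]
  | app s t ih₁ ih₂ => simp [rename, subst, ih₁, ih₂]
  | tau s ih => simp [rename, subst, ih]

theorem subst_rename (σ : ℕ → FTerm) (ρ : ℕ → ℕ) (s : FTerm) :
    subst σ (rename ρ s) = subst (fun n => σ (ρ n)) s := by
  induction s generalizing σ ρ with
  | var n => rfl
  | lam s ih =>
    have : (fun n => up σ (upRen ρ n)) = up fun n => σ (ρ n) := by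
      funext n; cases n <;> rfl
    simp [rename, subst, ih, this]
  | app s t ih₁ ih₂ => simp [rename, subst, ih₁, ih₂]
  | tau s ih => simp [rename, subst, ih]

theorem rename_rename (ρ ρ' : ℕ → ℕ) (s : FTerm) :
    rename ρ (rename ρ' s) = rename (fun n => ρ (ρ' n)) s := by
  rw [rename_eq_subst, subst_rename, ← rename_eq_subst]

theorem rename_subst (ρ : ℕ → ℕ) (σ : ℕ → FTerm) (s : FTerm) :
    rename ρ (subst σ s) = subst (fun n => rename ρ (σ n)) s := by
  induction s generalizing σ ρ with
  | var n => rfl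
  | lam s ih =>
    have : (fun n => rename (upRen ρ) (up σ n)) = up fun n => rename ρ (σ n) := by
      funext n
      cases n with
      | zero => rfl
      | succ n => simp [up, rename_rename, upRen]
    simp [rename, subst, ih, this]
  | app s t ih₁ ih₂ => simp [rename, subst, ih₁, ih₂]
  | tau s ih => simp [rename, subst, ih]

theorem subst_subst (σ τ : ℕ → FTerm) (s : FTerm) :
    subst σ (subst τ s) = subst (fun n => subst σ (τ n)) s := by
  induction s generalizing σ τ with
  | var n => rfl
  | lam s ih =>
    have : (fun n => subst (up σ) (up τ n)) = up fun n => subst σ (τ n) := by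
      funext n
      cases n with
      | zero => rfl
      | succ n => simp [up, subst_rename, rename_subst]
    simp [subst, ih, this]
  | app s t ih₁ ih₂ => simp [subst, ih₁, ih₂]
  | tau s ih => simp [subst, ih]

theorem subst_id (s : FTerm) : subst var s = s := by
  induction s with
  | var n => rfl
  | lam s ih =>
    have : up var = var := by funext n; cases n <;> rfl
    simp [subst, this, ih]
  | app s t ih₁ ih₂ => simp [subst, ih₁, ih₂]
  | tau s ih => simp [subst, ih]

/-- The substitution lemma; it makes β-contraction commute with substitution, for the clocked rules
as well as for parallel reduction. -/
theorem subst_single_subst (σ : ℕ → FTerm) (s t : FTerm) :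
    subst σ (subst (single t) s) = subst (single (subst σ t)) (subst (up σ) s) := by
  rw [subst_subst, subst_subst]
  congr 1
  funext n
  cases n with
  | zero => rfl
  | succ n => exact ((subst_rename (single (subst σ t)) Nat.succ (σ n)).trans (subst_id _)).symm

/-! ### Rewriting of finite λτ-terms -/

open Relation (ReflTransGen)

/-- The closure of a relation of root steps under contexts. -/
inductive Step (R : FTerm → FTerm → Prop) : FTerm → FTerm → Prop
  | root {s t : FTerm} : R s t → Step R s t
  | lam {s s' : FTerm} : Step R s s' → Step R (lam s) (lam s')
  | appL {s s' : FTerm} (t : FTerm) : Step R s s' → Step R (app s t) (app s' t)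
  | appR (s : FTerm) {t t' : FTerm} : Step R t t' → Step R (app s t) (app s t')
  | tau {s s' : FTerm} : Step R s s' → Step R (tau s) (tau s')

/-- The β-rule. -/
inductive BetaRule : FTerm → FTerm → Prop
  | beta (s t : FTerm) : BetaRule (app (lam s) t) (subst (single t) s)

/-- The rules of the clocked λ-calculus on finite terms. -/
inductive Clocked : FTerm → FTerm → Prop
  | beta (s t : FTerm) : Clocked (app (lam s) t) (tau (subst (single t) s))
  | lift (s t : FTerm) : Clocked (app (tau s) t) (tau (app s t))

/-- Closure of a relation of root steps under substitution. -/
def Substitutive (R : FTerm → FTerm → Prop) : Prop :=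
  ∀ σ s t, R s t → R (subst σ s) (subst σ t)

theorem substitutive_clocked : Substitutive Clocked := by
  rintro σ _ _ (⟨s, t⟩ | ⟨s, t⟩)
  · simp only [subst, subst_single_subst]
    exact .beta _ _
  · exact .lift _ _

section Closure

variable {R : FTerm → FTerm → Prop}

theorem Step.subst (hR : Substitutive R) {s t : FTerm} (h : Step R s t) (σ : ℕ → FTerm) :
    Step R (subst σ s) (subst σ t) := by
  induction h generalizing σ with
  | root h => exact .root (hR _ _ _ h)
  | lam _ ih => exact .lam (ih _)
  | appL t _ ih => exact .appL _ (ih _)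
  | appR s _ ih => exact .appR _ (ih _)
  | tau _ ih => exact .tau (ih _)

theorem steps_lam {s s' : FTerm} (h : ReflTransGen (Step R) s s') :
    ReflTransGen (Step R) (lam s) (lam s') :=
  h.lift _ fun _ _ => .lam

theorem steps_tau {s s' : FTerm} (h : ReflTransGen (Step R) s s') :
    ReflTransGen (Step R) (tau s) (tau s') :=
  h.lift _ fun _ _ => .tau

theorem steps_app {s s' t t' : FTerm} (h : ReflTransGen (Step R) s s')
    (h' : ReflTransGen (Step R) t t') : ReflTransGen (Step R) (app s t) (app s' t') :=
  (h.lift (fun s => app s t) fun _ _ => .appL t).trans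
    (h'.lift (fun t => app s' t) fun _ _ => .appR s')

theorem steps_subst (hR : Substitutive R) {s s' : FTerm} (h : ReflTransGen (Step R) s s')
    (σ : ℕ → FTerm) : ReflTransGen (Step R) (subst σ s) (subst σ s') :=
  h.lift _ fun _ _ h => h.subst hR σ

theorem subst_steps (hR : Substitutive R) (s : FTerm) {σ σ' : ℕ → FTerm}
    (h : ∀ n, ReflTransGen (Step R) (σ n) (σ' n)) :
    ReflTransGen (Step R) (subst σ s) (subst σ' s) := by
  induction s generalizing σ σ' with
  | var n => exact h n
  | lam s ih =>
    refine steps_lam (ih fun n => ?_)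
    cases n with
    | zero => exact .refl
    | succ n =>
      simp only [up, rename_eq_subst]
      exact steps_subst hR (h n) _
  | app s t ih₁ ih₂ => exact steps_app (ih₁ h) (ih₂ h)
  | tau s ih => exact steps_tau (ih h)

theorem single_steps {t t' : FTerm} (h : ReflTransGen (Step R) t t') (n : ℕ) :
    ReflTransGen (Step R) (single t n) (single t' n) := by
  cases n with
  | zero => exact h
  | succ n => exact .refl

theorem steps_subst_single (hR : Substitutive R) {s s' t t' : FTerm}
    (h : ReflTransGen (Step R) s s') (h' : ReflTransGen (Step R) t t') :
    ReflTransGen (Step R) (subst (single t) s) (subst (single t') s') :=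
  (steps_subst hR h _).trans (subst_steps hR _ (single_steps h'))

end Closure

/-! ### Confluence of β-reduction -/

/-- Parallel β-reduction. -/
inductive Par : FTerm → FTerm → Prop
  | var (n : ℕ) : Par (var n) (var n)
  | lam {s s' : FTerm} : Par s s' → Par (lam s) (lam s')
  | app {s s' t t' : FTerm} : Par s s' → Par t t' → Par (app s t) (app s' t')
  | tau {s s' : FTerm} : Par s s' → Par (tau s) (tau s')
  | beta {s s' t t' : FTerm} : Par s s' → Par t t' →
      Par (app (lam s) t) (subst (single t') s')

theorem Par.refl (s : FTerm) : Par s s := by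
  induction s with
  | var n => exact .var n
  | lam s ih => exact .lam ih
  | app s t ih₁ ih₂ => exact .app ih₁ ih₂
  | tau s ih => exact .tau ih

theorem Par.rename {s s' : FTerm} (h : Par s s') (ρ : ℕ → ℕ) :
    Par (rename ρ s) (rename ρ s') := by
  induction h generalizing ρ with
  | var n => exact .var _
  | lam _ ih => exact .lam (ih _)
  | app _ _ ih₁ ih₂ => exact .app (ih₁ _) (ih₂ _)
  | tau _ ih => exact .tau (ih _)
  | @beta s s' t t' _ _ ih₁ ih₂ =>
    have : FTerm.rename ρ (FTerm.subst (single t') s') =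
        FTerm.subst (single (FTerm.rename ρ t')) (FTerm.rename (upRen ρ) s') := by
      rw [rename_subst, subst_rename]
      congr 1
      funext n
      cases n <;> rfl
    rw [this]
    exact .beta (ih₁ _) (ih₂ _)

theorem Par.subst {s s' : FTerm} (h : Par s s') {σ σ' : ℕ → FTerm}
    (hσ : ∀ n, Par (σ n) (σ' n)) : Par (subst σ s) (subst σ' s') := by
  have hup : ∀ {σ σ' : ℕ → FTerm}, (∀ n, Par (σ n) (σ' n)) → ∀ n, Par (up σ n) (up σ' n) := by
    intro σ σ' hσ n
    cases n with
    | zero => exact .var 0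
    | succ n => exact (hσ n).rename _
  induction h generalizing σ σ' with
  | var n => exact hσ n
  | lam _ ih => exact .lam (ih (hup hσ))
  | app _ _ ih₁ ih₂ => exact .app (ih₁ hσ) (ih₂ hσ)
  | tau _ ih => exact .tau (ih hσ)
  | beta _ _ ih₁ ih₂ =>
    rw [subst_single_subst]
    exact .beta (ih₁ (hup hσ)) (ih₂ hσ)

theorem Par.subst_single {s s' t t' : FTerm} (h : Par s s') (h' : Par t t') :
    Par (FTerm.subst (single t) s) (FTerm.subst (single t') s') := by
  refine h.subst fun n => ?_
  cases n with
  | zero => exact h'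
  | succ n => exact .var n

/-- The complete development: all β-redexes are contracted. -/
def dev : FTerm → FTerm
  | var n => var n
  | lam s => lam (dev s)
  | tau s => tau (dev s)
  -- The redex is sought in `s`, not in `dev s`, so redexes created by the development stay
  -- uncontracted. The development of an abstraction is an abstraction, so no redex is missed.
  | app s t => match s, dev s with
    | lam _, lam s' => subst (single (dev t)) s'
    | _, s' => app s' (dev t)

/-- Takahashi's triangle property: the complete development depends on `s` alone, hence closes every
peak of parallel steps from `s`. -/
theorem Par.dev {s t : FTerm} (h : Par s t) : Par t (dev s) := by
  induction h with
  | var n => exact .var n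
  | lam _ ih => exact .lam ih
  | tau _ ih => exact .tau ih
  | @app s s' t t' h _ ih₁ ih₂ =>
    cases s with
    | lam s =>
      cases h with
      | lam _ =>
        cases ih₁ with
        | lam ih₁ => exact .beta ih₁ ih₂
    | var n => exact .app ih₁ ih₂
    | app s₁ s₂ => exact .app ih₁ ih₂
    | tau s => exact .app ih₁ ih₂
  | beta _ _ ih₁ ih₂ => exact ih₁.subst_single ih₂

theorem Step.par {s t : FTerm} (h : Step BetaRule s t) : Par s t := by
  induction h with
  | root h => cases h; exact .beta (.refl _) (.refl _)
  | lam _ ih => exact .lam ih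
  | appL t _ ih => exact .app ih (.refl _)
  | appR s _ ih => exact .app (.refl _) ih
  | tau _ ih => exact .tau ih

theorem Par.steps {s t : FTerm} (h : Par s t) : ReflTransGen (Step BetaRule) s t := by
  induction h with
  | var n => exact .refl
  | lam _ ih => exact steps_lam ih
  | app _ _ ih₁ ih₂ => exact steps_app ih₁ ih₂
  | tau _ ih => exact steps_tau ih
  | beta _ _ ih₁ ih₂ => exact (steps_app (steps_lam ih₁) ih₂).tail (.root (.beta _ _))

theorem steps_iff_par {s t : FTerm} : ReflTransGen (Step BetaRule) s t ↔ ReflTransGen Par s t := by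
  constructor
  · exact fun h => ReflTransGen.mono (fun _ _ => Step.par) _ _ h
  · intro h
    induction h with
    | refl => exact .refl
    | tail _ h ih => exact ih.trans h.steps

theorem church_rosser {s t : FTerm} (h : Relation.EqvGen (Step BetaRule) s t) :
    ∃ u, ReflTransGen (Step BetaRule) s u ∧ ReflTransGen (Step BetaRule) t u := by
  induction h with
  | rel s t h => exact ⟨t, .single h, .refl⟩
  | refl s => exact ⟨s, .refl, .refl⟩
  | symm s t _ ih => exact ih.imp fun u h => h.symm
  | trans r s t _ _ ih₁ ih₂ =>
    obtain ⟨u, hu, hu'⟩ := ih₁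
    obtain ⟨v, hv, hv'⟩ := ih₂
    obtain ⟨w, hw, hw'⟩ := Relation.church_rosser
      (fun a b c hb hc => ⟨dev a, .single hb.dev, .single hc.dev⟩)
      (steps_iff_par.1 hu') (steps_iff_par.1 hv)
    exact ⟨w, hu.trans (steps_iff_par.2 hw), hv'.trans (steps_iff_par.2 hw')⟩

/-! ### Head reduction in the clocked calculus -/

/-- Application of a head-reduced term: contract the root redex, if there is one. -/
def headApp : FTerm → FTerm → FTerm
  | lam s, t => tau (subst (single t) s)
  | tau s, t => tau (app s t)
  | var n, t => app (var n) t
  | app r s, t => app (app r s) t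

/-- The result of clocked reduction along the spine until the root symbol is stable. -/
def head : FTerm → FTerm
  | var n => var n
  | lam s => lam s
  | app s t => headApp (head s) t
  | tau s => tau s

/-- The same root symbol, with related arguments. -/
inductive Below (S : FTerm → FTerm → Prop) : FTerm → FTerm → Prop
  | var (n : ℕ) : Below S (var n) (var n)
  | lam {s t : FTerm} : S s t → Below S (lam s) (lam t)
  | app {s s' t t' : FTerm} : S s t → S s' t' → Below S (app s s') (app t t')
  | tau {s t : FTerm} : S s t → Below S (tau s) (tau t)

theorem Below.refl {S : FTerm → FTerm → Prop} (hS : ∀ s, S s s) (s : FTerm) : Below S s s := by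
  cases s with
  | var n => exact .var n
  | lam s => exact .lam (hS _)
  | app s t => exact .app (hS _) (hS _)
  | tau s => exact .tau (hS _)

theorem Below.mono {S S' : FTerm → FTerm → Prop} (hS : ∀ s t, S s t → S' s t) {s t : FTerm}
    (h : Below S s t) : Below S' s t := by
  cases h with
  | var n => exact .var n
  | lam h => exact .lam (hS _ _ h)
  | app h₁ h₂ => exact .app (hS _ _ h₁) (hS _ _ h₂)
  | tau h => exact .tau (hS _ _ h)

theorem Below.trans {S : FTerm → FTerm → Prop} (hS : ∀ {r s t}, S r s → S s t → S r t)
    {r s t : FTerm} (h : Below S r s) (h' : Below S s t) : Below S r t := by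
  cases h with
  | var n => exact h'
  | lam h => cases h' with | lam h' => exact .lam (hS h h')
  | app h₁ h₂ => cases h' with | app h₁' h₂' => exact .app (hS h₁ h₁') (hS h₂ h₂')
  | tau h => cases h' with | tau h' => exact .tau (hS h h')

/-- The result of `headApp` depends only on the root of the function part, so closure of `S` under
application and substitution suffices. Used both for clocked rewriting and for parallel β-reduction.
-/
theorem Below.headApp {S : FTerm → FTerm → Prop}
    (hS_var : ∀ n, S (FTerm.var n) (FTerm.var n))
    (hS : ∀ {s s' t t'}, S s s' → S t t' → S (FTerm.app s t) (FTerm.app s' t'))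
    (hS' : ∀ {s s' t t'}, S s s' → S t t' → S (subst (single t) s) (subst (single t') s'))
    {s s' t t' : FTerm} (h : Below S s s') (ht : S t t') :
    Below S (headApp s t) (headApp s' t') := by
  cases h with
  | var n => exact .app (hS_var n) ht
  | lam h => exact .tau (hS' h ht)
  | app h₁ h₂ => exact .app (hS h₁ h₂) ht
  | tau h => exact .tau (hS h ht)

theorem steps_headApp (s t : FTerm) : ReflTransGen (Step Clocked) (app s t) (headApp s t) := by
  cases s with
  | lam s => exact .single (.root (.beta _ _))
  | tau s => exact .single (.root (.lift _ _))
  | var n => exact .refl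
  | app r s => exact .refl

theorem steps_head (s : FTerm) : ReflTransGen (Step Clocked) s (head s) := by
  induction s with
  | app s t ih _ => exact (steps_app ih .refl).trans (steps_headApp _ _)
  | _ => exact .refl

theorem head_head (s : FTerm) : head (head s) = head s := by
  induction s with
  | app s t ih _ =>
    simp only [head]
    cases h : head s with
    | app r s => rw [h] at ih; simp only [headApp, head] at ih ⊢; rw [ih]
    | _ => rfl
  | _ => rfl

/-- A clocked step does not change the root of the head form. -/
theorem Step.below_head {s t : FTerm} (h : Step Clocked s t) :
    Below (ReflTransGen (Step Clocked)) (head s) (head t) := by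
  have happ {s s' t t' : FTerm} (h : Below (ReflTransGen (Step Clocked)) s s')
      (ht : ReflTransGen (Step Clocked) t t') :=
    h.headApp (fun _ => .refl) steps_app (steps_subst_single substitutive_clocked) ht
  induction h with
  -- For both rules the head form of the redex is the contractum itself, which is stable because its
  -- root is `τ`.
  | root h => cases h <;> exact .refl (fun _ => .refl) _
  | lam h _ => exact .lam (.single h)
  | appL t _ ih => exact happ ih .refl
  | appR s h _ => exact happ (.refl (fun _ => .refl) _) (.single h)
  | tau h _ => exact .tau (.single h)

theorem below_head {s t : FTerm} (h : ReflTransGen (Step Clocked) s t) :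
    Below (ReflTransGen (Step Clocked)) (head s) (head t) := by
  induction h with
  | refl => exact .refl (fun _ => .refl) _
  | tail _ h ih => exact ih.trans .trans h.below_head

/-! ### Head forms under β-reduction -/

/-- Removal of the `τ` at the root of the head form. -/
def Peel (s t : FTerm) : Prop := head s = tau t

/-- The rule `τ(s) t → τ(s t)` carries the `τ` of the function part to the root, so peeling commutes
with supplying an argument. -/
theorem Peel.app {s s' : FTerm} (h : Peel s s') (t : FTerm) : Peel (app s t) (app s' t) := by
  simp only [Peel, head] at h ⊢
  rw [h]
  rfl

/-- `PeelBelow S s t`: after removing finitely many leading `τ`s from the head form of `s`, it has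
the root symbol of the head form of `t`, with arguments related by `S`. -/
def PeelBelow (S : FTerm → FTerm → Prop) (s t : FTerm) : Prop :=
  ∃ s', ReflTransGen Peel s s' ∧ Below S (head s') (head t)

theorem PeelBelow.app {s s' t t' : FTerm} (h : PeelBelow Par s s') (ht : Par t t') :
    PeelBelow Par (app s t) (app s' t') := by
  obtain ⟨u, hu, h⟩ := h
  exact ⟨_, hu.lift (fun s => FTerm.app s t) fun _ _ h => h.app t,
    h.headApp .var .app Par.subst_single ht⟩

/-- Substitutions are needed for the induction: after a β-contraction the argument may land in head
position. There `hσ'` controls head forms, while `hσ` serves all positions below the root. -/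
theorem Par.peelBelow_subst {s s' : FTerm} (h : Par s s') {σ σ' : ℕ → FTerm}
    (hσ : ∀ n, Par (σ n) (σ' n)) (hσ' : ∀ n, PeelBelow Par (σ n) (σ' n)) :
    PeelBelow Par (FTerm.subst σ s) (FTerm.subst σ' s') := by
  induction h generalizing σ σ' with
  | var n => exact hσ' n
  | lam h _ =>
    have h := h.lam.subst hσ
    cases h with | lam h => exact ⟨_, .refl, .lam h⟩
  | tau h _ => exact ⟨_, .refl, .tau (h.subst hσ)⟩
  | app _ h ih _ => exact (ih hσ hσ').app (h.subst hσ)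
  | @beta s s' t t' hs ht ih₁ ih₂ =>
    -- The contractum under `σ` is the body under this extended substitution, which sends `0` to the
    -- instance of the argument. The induction hypothesis for the argument gives its head condition
    -- at `0`.
    let ext (σ : ℕ → FTerm) (t : FTerm) : ℕ → FTerm := fun n => FTerm.subst σ (single t n)
    obtain ⟨u, hu, h⟩ := ih₁ (σ := ext σ t) (σ' := ext σ' t')
      (by
        intro n
        cases n with
        | zero => exact ht.subst hσ
        | succ n => exact hσ n)
      (by
        intro n
        cases n with
        | zero => exact ih₂ hσ hσ'
        | succ n => exact hσ' n)
    rw [subst_subst]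
    -- The extra peel removes the `τ` produced by the redex that is still present on the left only.
    refine ⟨u, .head ?_ hu, h⟩
    rw [← subst_subst, subst_single_subst]
    rfl

/-- Parallel β-reduction can only remove `τ`s from head forms. -/
theorem Par.peelBelow {s t : FTerm} (h : Par s t) : PeelBelow Par s t := by
  have := h.peelBelow_subst (fun n => .var n) (fun n => ⟨_, .refl, .var n⟩)
  rwa [subst_id, subst_id] at this

/-- Each `τ` peeled from `t` is matched in `s`, possibly after some surplus ones. This lets
comparisons of head forms be chained along a sequence of parallel steps. -/
theorem Par.peel {s t t' : FTerm} (h : Par s t) (ht : ReflTransGen Peel t t') :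
    ∃ s', ReflTransGen Peel s s' ∧ Par s' t' := by
  induction ht with
  | refl => exact ⟨s, .refl, h⟩
  | @tail t u _ htu ih =>
    obtain ⟨s', hs, h⟩ := ih
    obtain ⟨v, hv, h⟩ := h.peelBelow
    rw [htu] at h
    generalize hw : head v = w at h
    cases h with | tau h => exact ⟨_, (hs.trans hv).tail hw, h⟩

/-- β-reduction can only remove `τ`s from head forms. -/
theorem peelBelow_of_pars {s t : FTerm} (h : ReflTransGen Par s t) :
    PeelBelow (ReflTransGen Par) s t := by
  induction h using ReflTransGen.head_induction_on with
  | refl => exact ⟨_, .refl, .refl (fun _ => .refl) _⟩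
  | head h _ ih =>
    obtain ⟨u, hu, hut⟩ := ih
    obtain ⟨v, hv, h⟩ := h.peel hu
    obtain ⟨w, hw, h⟩ := h.peelBelow
    exact ⟨w, hv.trans hw, (h.mono fun _ _ => .single).trans .trans hut⟩

/-- The number of applications between the root and the head. -/
def spine : FTerm → ℕ
  | app s _ => spine s + 1
  | _ => 0

/-- A root step yields a `τ`, whose spine is empty. Term size, by contrast, may grow, so the spine
is what later supports an induction across clocked reductions. -/
theorem Step.spine_le {s t : FTerm} (h : Step Clocked s t) : spine t ≤ spine s := by
  induction h with
  | root h => cases h <;> exact Nat.zero_le _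
  | appL t _ ih => exact Nat.succ_le_succ ih
  | _ => exact le_rfl

theorem spine_le {s t : FTerm} (h : ReflTransGen (Step Clocked) s t) : spine t ≤ spine s := by
  induction h with
  | refl => exact le_rfl
  | tail _ h ih => exact h.spine_le.trans ih

/-! ### The infinite tree of a finite term -/

def layer : FTerm → sig FTerm
  | var n => ⟨Sym.var n, (Fin.elim0 : Fin 0 → FTerm)⟩
  | lam s => ⟨Sym.lam, (fun _ => s : Fin 1 → FTerm)⟩
  | app s t => ⟨Sym.app, (![s, t] : Fin 2 → FTerm)⟩
  | tau s => ⟨Sym.tau, (fun _ => s : Fin 1 → FTerm)⟩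

/-- The clocked Lévy tree of a finite λτ-term, generated by head reduction. -/
def tree (s : FTerm) : ITerm := PFunctor.M.corec (fun s => layer (head s)) s

theorem tree_eq (s : FTerm) : tree s = PFunctor.M.mk (sig.map tree (layer (head s))) :=
  PFunctor.M.corec_def _ _

theorem tree_head (s : FTerm) : tree (head s) = tree s := by
  rw [tree_eq, tree_eq s, head_head]

theorem tree_var {s : FTerm} {n : ℕ} (h : head s = var n) : tree s = ITerm.var n := by
  rw [tree_eq, h]
  exact ITerm.mk_congr (a := Sym.var n) fun i => Fin.elim0 i

theorem tree_lam {s t : FTerm} (h : head s = lam t) : tree s = ITerm.lam (tree t) := by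
  rw [tree_eq, h]
  rfl

theorem tree_tau {s t : FTerm} (h : head s = tau t) : tree s = ITerm.tau (tree t) := by
  rw [tree_eq, h]
  rfl

theorem tree_app {s t u : FTerm} (h : head s = app t u) :
    tree s = ITerm.app (tree t) (tree u) := by
  rw [tree_eq, h]
  exact ITerm.mk_congr (a := Sym.app) (Fin.forall_fin_two.2 ⟨rfl, rfl⟩)

end FTerm

/-! ### Infinite terms -/

namespace ITerm

/-- The root symbol. -/
def root (t : ITerm) : Sym := (PFunctor.M.dest t).1

@[simp] theorem root_var (n : ℕ) : root (var n) = Sym.var n := rfl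
@[simp] theorem root_lam (t : ITerm) : root (lam t) = Sym.lam := rfl
@[simp] theorem root_app (s t : ITerm) : root (app s t) = Sym.app := rfl
@[simp] theorem root_tau (t : ITerm) : root (tau t) = Sym.tau := rfl

theorem lam_injective : Function.Injective lam := by
  intro s t h
  exact congrFun (eq_of_heq (Sigma.mk.inj (PFunctor.M.mk_inj h)).2) (0 : Fin 1)

theorem tau_injective : Function.Injective tau := by
  intro s t h
  exact congrFun (eq_of_heq (Sigma.mk.inj (PFunctor.M.mk_inj h)).2) (0 : Fin 1)

theorem app_inj {r s t u : ITerm} (h : app r s = app t u) : r = t ∧ s = u := by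
  have := eq_of_heq (Sigma.mk.inj (PFunctor.M.mk_inj h)).2
  exact ⟨congrFun this (0 : Fin 2), congrFun this (1 : Fin 2)⟩

theorem eq_of_below {S : ITerm → ITerm → Prop} (hS : ∀ a b, S a b → Below S a b) {a b : ITerm}
    (h : S a b) : a = b := by
  refine PFunctor.M.bisim S (fun a b h => ?_) a b h
  cases hS a b h with
  | var n => exact ⟨Sym.var n, _, _, rfl, rfl, fun i => Fin.elim0 i⟩
  | @lam s t h' => exact ⟨Sym.lam, fun _ => s, fun _ => t, rfl, rfl, fun _ => h'⟩
  | @app s s' t t' h₁ h₂ =>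
    exact ⟨Sym.app, ![s, s'], ![t, t'], rfl, rfl, Fin.forall_fin_two.2 ⟨h₁, h₂⟩⟩
  | @tau s t h' => exact ⟨Sym.tau, fun _ => s, fun _ => t, rfl, rfl, fun _ => h'⟩

end ITerm

/-! ### Embeddings -/

open Relation (ReflTransGen)

namespace FTerm

def toITerm : FTerm → ITerm
  | var n => ITerm.var n
  | lam s => ITerm.lam s.toITerm
  | app s t => ITerm.app s.toITerm t.toITerm
  | tau s => ITerm.tau s.toITerm

theorem toITerm_rename (ρ : ℕ → ℕ) (s : FTerm) :
    (rename ρ s).toITerm = ITerm.rename ρ s.toITerm := by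
  induction s generalizing ρ with
  | var n => exact (ITerm.rename_var _ _).symm
  | lam s ih => simp [rename, toITerm, ITerm.rename_lam, ih]
  | app s t ih₁ ih₂ => simp [rename, toITerm, ITerm.rename_app, ih₁, ih₂]
  | tau s ih => simp [rename, toITerm, ITerm.rename_tau, ih]

theorem toITerm_subst (σ : ℕ → FTerm) (s : FTerm) :
    (subst σ s).toITerm = ITerm.subst (fun n => (σ n).toITerm) s.toITerm := by
  induction s generalizing σ with
  | var n => exact (ITerm.subst_var (fun n => (σ n).toITerm) n).symm
  | lam s ih =>
    have : (fun n => (up σ n).toITerm) = ITerm.up fun n => (σ n).toITerm := by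
      funext n
      cases n with
      | zero => rfl
      | succ n => exact toITerm_rename _ _
    simp [subst, toITerm, ITerm.subst_lam, ih, this]
  | app s t ih₁ ih₂ => simp [subst, toITerm, ITerm.subst_app, ih₁, ih₂]
  | tau s ih => simp [subst, toITerm, ITerm.subst_tau, ih]

theorem toITerm_subst_single (s t : FTerm) :
    (subst (single t) s).toITerm = ITerm.subst (ITerm.single t.toITerm) s.toITerm := by
  rw [toITerm_subst]
  congr 1
  funext n
  cases n <;> rfl

theorem toITerm_eq_lam {s : FTerm} {a : ITerm} (h : s.toITerm = ITerm.lam a) :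
    ∃ t, s = lam t ∧ t.toITerm = a := by
  cases s with
  | lam s => exact ⟨s, rfl, ITerm.lam_injective h⟩
  | _ => simpa [toITerm] using congrArg ITerm.root h

theorem toITerm_eq_tau {s : FTerm} {a : ITerm} (h : s.toITerm = ITerm.tau a) :
    ∃ t, s = tau t ∧ t.toITerm = a := by
  cases s with
  | tau s => exact ⟨s, rfl, ITerm.tau_injective h⟩
  | _ => simpa [toITerm] using congrArg ITerm.root h

theorem toITerm_eq_app {s : FTerm} {a b : ITerm} (h : s.toITerm = ITerm.app a b) :
    ∃ t u, s = app t u ∧ t.toITerm = a ∧ u.toITerm = b := by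
  cases s with
  | app s t => exact ⟨s, t, rfl, ITerm.app_inj h⟩
  | _ => simpa [toITerm] using congrArg ITerm.root h

theorem toITerm_eq_var {s : FTerm} {n : ℕ} (h : s.toITerm = ITerm.var n) : s = var n := by
  cases s with
  | var m =>
    have := congrArg ITerm.root h
    simp only [toITerm, ITerm.root_var, Sym.var.injEq] at this
    rw [this]
  | _ => simpa [toITerm] using congrArg ITerm.root h

theorem Step.toITerm {s t : FTerm} (h : Step Clocked s t) :
    ClockedLambda.Step ClockedRule s.toITerm t.toITerm := by
  induction h with
  | root h =>
    cases h with
    | beta s t =>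
      simp only [FTerm.toITerm, toITerm_subst_single]
      exact .root (.beta _ _)
    | lift s t => exact .root (.lift _ _)
  | lam _ ih => exact .lam ih
  | appL t _ ih => exact .appL _ ih
  | appR s _ ih => exact .appR _ ih
  | tau _ ih => exact .tau ih

theorem exists_of_step {s : FTerm} {b : ITerm}
    (h : ClockedLambda.Step ClockedRule s.toITerm b) : ∃ t, Step Clocked s t ∧ t.toITerm = b := by
  generalize ha : s.toITerm = a at h
  induction h generalizing s with
  | root h =>
    cases h with
    | beta a b =>
      obtain ⟨r, t, rfl, hr, rfl⟩ := toITerm_eq_app ha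
      obtain ⟨s, rfl, rfl⟩ := toITerm_eq_lam hr
      exact ⟨_, .root (.beta s t), congrArg ITerm.tau (toITerm_subst_single s t)⟩
    | lift a b =>
      obtain ⟨r, t, rfl, hr, rfl⟩ := toITerm_eq_app ha
      obtain ⟨s, rfl, rfl⟩ := toITerm_eq_tau hr
      exact ⟨_, .root (.lift s t), rfl⟩
  | lam _ ih =>
    obtain ⟨s, rfl, hs⟩ := toITerm_eq_lam ha
    obtain ⟨t, ht, rfl⟩ := ih hs
    exact ⟨_, .lam ht, rfl⟩
  | appL _ _ ih =>
    obtain ⟨s, u, rfl, hs, rfl⟩ := toITerm_eq_app ha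
    obtain ⟨t, ht, rfl⟩ := ih hs
    exact ⟨_, .appL u ht, rfl⟩
  | appR _ _ ih =>
    obtain ⟨u, s, rfl, rfl, hs⟩ := toITerm_eq_app ha
    obtain ⟨t, ht, rfl⟩ := ih hs
    exact ⟨_, .appR u ht, rfl⟩
  | tau _ ih =>
    obtain ⟨s, rfl, hs⟩ := toITerm_eq_tau ha
    obtain ⟨t, ht, rfl⟩ := ih hs
    exact ⟨_, .tau ht, rfl⟩

/-- Finite terms are closed under finite clocked rewriting, so every intermediate term of an
infinitary reduction from a finite term can be analysed with `head`. -/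
theorem exists_of_steps {s : FTerm} {b : ITerm}
    (h : ReflTransGen (ClockedLambda.Step ClockedRule) s.toITerm b) :
    ∃ t, ReflTransGen (Step Clocked) s t ∧ t.toITerm = b := by
  induction h with
  | refl => exact ⟨s, .refl, rfl⟩
  | tail _ h ih =>
    obtain ⟨t, ht, rfl⟩ := ih
    obtain ⟨u, hu, rfl⟩ := exists_of_step h
    exact ⟨u, ht.tail hu, rfl⟩

end FTerm

/-! ### The clocked Lévy tree of a finite term -/

theorem Below.mono {S S' : ITerm → ITerm → Prop} (hS : ∀ a b, S a b → S' a b) {a b : ITerm}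
    (h : Below S a b) : Below S' a b := by
  cases h with
  | var n => exact .var n
  | lam h => exact .lam (hS _ _ h)
  | app h₁ h₂ => exact .app (hS _ _ h₁) (hS _ _ h₂)
  | tau h => exact .tau (hS _ _ h)

theorem InfRed.exists_below {R : ITerm → ITerm → Prop} {a b : ITerm} (h : InfRed R a b) :
    ∃ c, ReflTransGen (Step R) a c ∧ Below (InfRed R) c b := by
  obtain ⟨S, hab, hS⟩ := h
  obtain ⟨c, hc, h⟩ := hS a b hab
  exact ⟨c, hc, h.mono fun a b h => ⟨S, h, hS⟩⟩

namespace FTerm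

theorem below_toITerm_tree (s : FTerm) :
    ClockedLambda.Below (fun a b => ∃ t : FTerm, t.toITerm = a ∧ tree t = b)
      (head s).toITerm (tree s) := by
  cases h : head s with
  | var n => rw [tree_var h]; exact .var n
  | lam t => rw [tree_lam h]; exact .lam ⟨_, rfl, rfl⟩
  | app t u => rw [tree_app h]; exact .app ⟨_, rfl, rfl⟩ ⟨_, rfl, rfl⟩
  | tau t => rw [tree_tau h]; exact .tau ⟨_, rfl, rfl⟩

theorem infRed_tree (s : FTerm) : InfRed ClockedRule s.toITerm (tree s) := by
  refine ⟨fun a b => ∃ t : FTerm, t.toITerm = a ∧ tree t = b, ⟨s, rfl, rfl⟩, ?_⟩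
  rintro _ _ ⟨t, rfl, rfl⟩
  exact ⟨_, (steps_head t).lift FTerm.toITerm fun _ _ => Step.toITerm, below_toITerm_tree t⟩

theorem tree_eq_lam {s : FTerm} {a : ITerm} (h : tree s = ITerm.lam a) :
    ∃ t, head s = lam t ∧ tree t = a := by
  cases hs : head s with
  | var n => rw [tree_var hs] at h; simpa using congrArg ITerm.root h
  | lam t => rw [tree_lam hs] at h; exact ⟨t, rfl, ITerm.lam_injective h⟩
  | app t u => rw [tree_app hs] at h; simpa using congrArg ITerm.root h
  | tau t => rw [tree_tau hs] at h; simpa using congrArg ITerm.root h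

theorem tree_eq_tau {s : FTerm} {a : ITerm} (h : tree s = ITerm.tau a) :
    ∃ t, head s = tau t ∧ tree t = a := by
  cases hs : head s with
  | var n => rw [tree_var hs] at h; simpa using congrArg ITerm.root h
  | lam t => rw [tree_lam hs] at h; simpa using congrArg ITerm.root h
  | app t u => rw [tree_app hs] at h; simpa using congrArg ITerm.root h
  | tau t => rw [tree_tau hs] at h; exact ⟨t, rfl, ITerm.tau_injective h⟩

theorem tree_eq_app {s : FTerm} {a b : ITerm} (h : tree s = ITerm.app a b) :
    ∃ t u, head s = app t u ∧ tree t = a ∧ tree u = b := by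
  cases hs : head s with
  | var n => rw [tree_var hs] at h; simpa using congrArg ITerm.root h
  | lam t => rw [tree_lam hs] at h; simpa using congrArg ITerm.root h
  | app t u => rw [tree_app hs] at h; exact ⟨t, u, rfl, ITerm.app_inj h⟩
  | tau t => rw [tree_tau hs] at h; simpa using congrArg ITerm.root h

/-- In a head form that is an application, the function part has no root redex above it. -/
theorem headApp_head_of_head_eq_app {s t u : FTerm} (h : head s = app t u) :
    headApp (head t) u = app t u := by
  have := head_head s
  rwa [h] at this

theorem normalForm_tree (s : FTerm) : NormalForm ClockedRule (tree s) := by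
  intro b h
  generalize ha : tree s = a at h
  induction h generalizing s with
  | root h =>
    cases h with
    | beta a b =>
      obtain ⟨t, u, hs, ht, -⟩ := tree_eq_app ha
      obtain ⟨v, hv, -⟩ := tree_eq_lam ht
      have := headApp_head_of_head_eq_app hs
      rw [hv] at this
      -- Stability of `app t u` is violated: with an abstraction as head form of `t`, `headApp`
      -- would produce a `τ`.
      cases this
    | lift a b =>
      obtain ⟨t, u, hs, ht, -⟩ := tree_eq_app ha
      obtain ⟨v, hv, -⟩ := tree_eq_tau ht
      have := headApp_head_of_head_eq_app hs
      rw [hv] at this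
      cases this
  | lam _ ih => obtain ⟨t, -, ht⟩ := tree_eq_lam ha; exact ih t ht
  | appL _ _ ih => obtain ⟨t, _, -, ht, -⟩ := tree_eq_app ha; exact ih t ht
  | appR _ _ ih => obtain ⟨_, t, -, -, ht⟩ := tree_eq_app ha; exact ih t ht
  | tau _ ih => obtain ⟨t, -, ht⟩ := tree_eq_tau ha; exact ih t ht

theorem below_tree {S : FTerm → FTerm → Prop} {s t : FTerm} (h : Below S (head s) (head t)) :
    ClockedLambda.Below (fun a b => ∃ s t, S s t ∧ tree s = a ∧ tree t = b) (tree s) (tree t) := by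
  generalize hs : head s = s' at h
  generalize ht : head t = t' at h
  cases h with
  | var n => rw [tree_var hs, tree_var ht]; exact .var n
  | lam h => rw [tree_lam hs, tree_lam ht]; exact .lam ⟨_, _, h, rfl, rfl⟩
  | app h₁ h₂ =>
    rw [tree_app hs, tree_app ht]
    exact .app ⟨_, _, h₁, rfl, rfl⟩ ⟨_, _, h₂, rfl, rfl⟩
  | tau h => rw [tree_tau hs, tree_tau ht]; exact .tau ⟨_, _, h, rfl, rfl⟩

/-- Clocked steps preserve the root of the head form and relate its arguments by clocked steps, so
the trees are bisimilar. -/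
theorem tree_eq_of_steps {s t : FTerm} (h : ReflTransGen (Step Clocked) s t) :
    tree s = tree t := by
  refine ITerm.eq_of_below
    (S := fun a b => ∃ s t, ReflTransGen (Step Clocked) s t ∧ tree s = a ∧ tree t = b) ?_
    ⟨s, t, h, rfl, rfl⟩
  rintro _ _ ⟨s, t, h, rfl, rfl⟩
  exact below_tree (below_head h)

theorem exists_below_of_infRed {s : FTerm} {a : ITerm} (h : InfRed ClockedRule s.toITerm a) :
    ∃ t, ReflTransGen (Step Clocked) s t ∧
      ClockedLambda.Below (InfRed ClockedRule) t.toITerm a := by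
  obtain ⟨c, hc, h⟩ := h.exists_below
  obtain ⟨t, ht, rfl⟩ := exists_of_steps hc
  exact ⟨t, ht, h⟩

end FTerm

/-! ### Uniqueness of the clocked Lévy tree -/

theorem NormalForm.of_app {R : ITerm → ITerm → Prop} {a b : ITerm}
    (h : NormalForm R (ITerm.app a b)) : NormalForm R a ∧ NormalForm R b :=
  ⟨fun _ hc => h _ (.appL _ hc), fun _ hc => h _ (.appR _ hc)⟩

namespace FTerm

/-- Normality forbids `a` to start with an abstraction or `τ`. The head form of `s` must then have
the root of `a`, so applying it to `t` creates no redex. -/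
theorem head_app_of_infRed (s t : FTerm) {a b : ITerm} (h : InfRed ClockedRule s.toITerm a)
    (hab : NormalForm ClockedRule (ITerm.app a b)) : head (app s t) = app (head s) t := by
  induction hn : spine s using Nat.strong_induction_on generalizing s t a b with
  | _ n ih =>
  obtain ⟨u, hu, h⟩ := exists_below_of_infRed h
  have hsu := FTerm.below_head hu
  generalize hc : u.toITerm = c at h
  cases h with
  | var n =>
    cases toITerm_eq_var hc
    generalize hv : head s = v at hsu
    cases hsu
    simp [head, hv, headApp]
  | lam h => exact (hab _ (.root (.beta _ _))).elim
  | tau h => exact (hab _ (.root (.lift _ _))).elim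
  | app h₁ h₂ =>
    obtain ⟨v, w, rfl, rfl, rfl⟩ := toITerm_eq_app hc
    have := spine_le hu
    simp only [spine] at this
    -- That `u` is an application does not make its head form one; this needs the claim for its
    -- function part `v`, whose spine is shorter than that of `s`.
    have := ih (spine v) (by omega) v w h₁ hab.of_app.1 rfl
    rw [this] at hsu
    generalize hv : head s = x at hsu
    cases hsu
    simp [head, hv, headApp]

theorem eq_tree {s : FTerm} {a : ITerm} (h : InfRed ClockedRule s.toITerm a)
    (ha : NormalForm ClockedRule a) : a = tree s := by
  refine ITerm.eq_of_below (S := fun a b => ∃ s : FTerm, InfRed ClockedRule s.toITerm a ∧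
    NormalForm ClockedRule a ∧ tree s = b) ?_ ⟨s, h, ha, rfl⟩
  rintro a _ ⟨s, h, ha, rfl⟩
  obtain ⟨t, ht, h⟩ := exists_below_of_infRed h
  rw [tree_eq_of_steps ht]
  generalize hc : t.toITerm = c at h
  cases h with
  | var n => cases toITerm_eq_var hc; rw [tree_var rfl]; exact .var n
  | lam h =>
    obtain ⟨t, rfl, rfl⟩ := toITerm_eq_lam hc
    rw [tree_lam rfl]
    exact .lam ⟨t, h, fun _ hc => ha _ (.lam hc), rfl⟩
  | tau h =>
    obtain ⟨t, rfl, rfl⟩ := toITerm_eq_tau hc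
    rw [tree_tau rfl]
    exact .tau ⟨t, h, fun _ hc => ha _ (.tau hc), rfl⟩
  | app h₁ h₂ =>
    obtain ⟨t, u, rfl, rfl, rfl⟩ := toITerm_eq_app hc
    rw [tree_app (head_app_of_infRed t u h₁ ha), tree_head]
    exact .app ⟨t, h₁, ha.of_app.1, rfl⟩ ⟨u, h₂, ha.of_app.2, rfl⟩

theorem isClockedLevyTree_tree (s : FTerm) : IsClockedLevyTree s.toITerm (tree s) :=
  ⟨⟨infRed_tree s, normalForm_tree s⟩, fun _ h => eq_tree h.1 h.2⟩

/-- Peeling a term deletes the root `τ` of its tree, so `peelBelow_of_pars` says that the pairs of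
trees of a term and a β-reduct form a relation as required by `InfRed`. -/
theorem infRed_tau_tree {s t : FTerm} (h : ReflTransGen (Step BetaRule) s t) :
    InfRed TauRule (tree s) (tree t) := by
  refine ⟨fun a b => ∃ s t, ReflTransGen Par s t ∧ tree s = a ∧ tree t = b,
    ⟨s, t, steps_iff_par.1 h, rfl, rfl⟩, ?_⟩
  rintro _ _ ⟨s, t, h, rfl, rfl⟩
  obtain ⟨u, hu, h⟩ := peelBelow_of_pars h
  refine ⟨tree u, hu.lift tree fun s s' h => ?_, below_tree h⟩
  change ClockedLambda.Step TauRule (tree s) (tree s')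
  rw [tree_tau h]
  exact .root (.del _)

end FTerm

/-! ### λ-terms as `τ`-free finite λτ-terms -/

namespace Term

def toFTerm : Term → FTerm
  | var n => FTerm.var n
  | lam M => FTerm.lam M.toFTerm
  | app M N => FTerm.app M.toFTerm N.toFTerm

theorem toITerm_toFTerm (M : Term) : M.toFTerm.toITerm = M.toITerm := by
  induction M with
  | var n => rfl
  | lam M ih => exact congrArg ITerm.lam ih
  | app M N ih₁ ih₂ => exact congrArg₂ ITerm.app ih₁ ih₂

theorem toFTerm_rename (ρ : ℕ → ℕ) (M : Term) :
    (rename ρ M).toFTerm = FTerm.rename ρ M.toFTerm := by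
  induction M generalizing ρ with
  | var n => rfl
  | lam M ih => exact congrArg FTerm.lam (ih _)
  | app M N ih₁ ih₂ => exact congrArg₂ FTerm.app (ih₁ _) (ih₂ _)

theorem toFTerm_subst (σ : ℕ → Term) (M : Term) :
    (subst σ M).toFTerm = FTerm.subst (fun n => (σ n).toFTerm) M.toFTerm := by
  induction M generalizing σ with
  | var n => rfl
  | lam M ih =>
    have : (fun n => (up σ n).toFTerm) = FTerm.up fun n => (σ n).toFTerm := by
      funext n
      cases n with
      | zero => rfl
      | succ n => exact toFTerm_rename _ _
    simp [subst, toFTerm, FTerm.subst, ih, this]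
  | app M N ih₁ ih₂ => exact congrArg₂ FTerm.app (ih₁ _) (ih₂ _)

theorem toFTerm_subst_single (M N : Term) :
    (subst (single N) M).toFTerm = FTerm.subst (FTerm.single N.toFTerm) M.toFTerm := by
  rw [toFTerm_subst]
  congr 1
  funext n
  cases n <;> rfl

theorem Beta.toFTerm {M N : Term} (h : Beta M N) :
    FTerm.Step FTerm.BetaRule M.toFTerm N.toFTerm := by
  induction h with
  | beta M N => rw [toFTerm_subst_single]; exact .root (.beta _ _)
  | lam _ ih => exact .lam ih
  | appL N _ ih => exact .appL _ ih
  | appR M _ ih => exact .appR _ ih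

/-- β-steps create no `τ`; hence the common reduct found among λτ-terms is a genuine λ-term. -/
theorem exists_of_step {M : Term} {t : FTerm} (h : FTerm.Step FTerm.BetaRule M.toFTerm t) :
    ∃ N, Beta M N ∧ N.toFTerm = t := by
  induction M generalizing t with
  | var n => cases h with | root h => cases h
  | lam M ih =>
    cases h with
    | root h => cases h
    | lam h =>
      obtain ⟨N, hN, rfl⟩ := ih h
      exact ⟨_, .lam hN, rfl⟩
  | app M N ih₁ ih₂ =>
    cases h with
    | root h =>
      cases M with
      | lam M => cases h; exact ⟨_, .beta M N, toFTerm_subst_single M N⟩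
      | _ => cases h
    | appL _ h =>
      obtain ⟨P, hP, rfl⟩ := ih₁ h
      exact ⟨_, .appL N hP, rfl⟩
    | appR _ h =>
      obtain ⟨P, hP, rfl⟩ := ih₂ h
      exact ⟨_, .appR M hP, rfl⟩

theorem exists_of_steps {M : Term} {t : FTerm}
    (h : ReflTransGen (FTerm.Step FTerm.BetaRule) M.toFTerm t) :
    ∃ N, M.Reduces N ∧ N.toFTerm = t := by
  induction h with
  | refl => exact ⟨M, .refl, rfl⟩
  | tail _ h ih =>
    obtain ⟨N, hN, rfl⟩ := ih
    obtain ⟨P, hP, rfl⟩ := exists_of_step h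
    exact ⟨P, hN.tail hP, rfl⟩

theorem Conv.toFTerm {M N : Term} (h : M.Conv N) :
    Relation.EqvGen (FTerm.Step FTerm.BetaRule) M.toFTerm N.toFTerm := by
  induction h with
  | rel _ _ h => exact .rel _ _ h.toFTerm
  | refl _ => exact .refl _
  | symm _ _ _ ih => exact .symm _ _ ih
  | trans _ _ _ _ _ ih₁ ih₂ => exact .trans _ _ _ ih₁ ih₂

end Term

end ClockedLambda

theorem mainTheorem3 (M N : ClockedLambda.Term)
    (h : ∀ P : ClockedLambda.Term, M.Reduces P →
      ¬ ClockedLambda.GloballyImprovedBy N.toITerm P.toITerm) :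
    ¬ M.Conv N := by
  intro hMN
  obtain ⟨t, hM, hN⟩ := ClockedLambda.FTerm.church_rosser hMN.toFTerm
  obtain ⟨P, hMP, rfl⟩ := ClockedLambda.Term.exists_of_steps hM
  refine h P hMP ⟨_, _, ?_, ?_, ClockedLambda.FTerm.infRed_tau_tree hN⟩
  · rw [← ClockedLambda.Term.toITerm_toFTerm]
    exact ClockedLambda.FTerm.isClockedLevyTree_tree _
  · rw [← ClockedLambda.Term.toITerm_toFTerm]
    exact ClockedLambda.FTerm.isClockedLevyTree_tree _
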